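/- Let $d\ge 1$ and let $\mathcal X=[0,\infty)^{\mathbb Z^d}$ be the set of height configurations, with its Borel $\sigma$-field. A site $x$ is unstable in $\eta\in\mathcal X$ if $\eta_x\ge 1$. In the Markov toppling process started from $\eta$, every site carries an independent rate $1$ Poisson clock; when the clock of $x$ rings and $x$ is unstable at that moment, the height at $x$ is set to $0$ and each of the $2d$ nearest neighbours of $x$ receives $\frac1{2d}$ of the former height of $x$; if $x$ is stable, nothing happens. Let $M(x,t,\eta)$ be the number of topplings at $x$ up to and including time $t$. The configuration $\eta$ is stabilizable if almost surely $\lim_{t\to\infty}M(x,t,\eta)<\infty$ for every $x\in\mathbb Z^d$; $\mathcal S$ denotes the set of stabilizable configurations. A probability measure $\mu$ on $\mathcal X$ is stabilizable if $\mu(\mathcal S)=1$. An ergodic measure of density $\rho$ is a probability measure on $\mathcal X$ that is invariant and ergodic under the translations of $\mathbb Z^d$ and satisfies $\mathbb E_\mu(\eta_0)=\rho$. Theorem. (1) For every real $\rho$ with $\frac12\le\rho<\frac{d}{2d-1}$ there is an ergodic measure $\mu_\rho$ of density $\rho$ that is not stabilizable, and in fact $\mu_\rho(\mathcal S)=0$.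 It can be chosen such that $\mu_\rho$-almost every configuration is a translate of the checkerboard with mass $2\rho$ at the sites whose coordinate sum is even and mass $0$ at the sites whose coordinate sum is odd. (2) For every real $\rho$ with $\frac{2d-1}{2d}<\rho<1$ there is an ergodic measure $\mu_\rho$ of density $\rho$ that is not stabilizable, and in fact $\mu_\rho(\mathcal S)=0$. It can be chosen such that $\mu_\rho$-almost every configuration has all its heights at least $1-\frac1{2d}$. -/

import Mathlib

open MeasureTheory ProbabilityTheory Filter Topology
open scoped NNReal ENNReal

namespace ZhangSandpile

/-- The sites of the lattice `ℤ^d`. -/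
abbrev Site (d : ℕ) : Type := Fin d → ℤ

/-- Height configurations `[0, ∞)^(ℤ^d)`, with the product (Borel) sigma-algebra. -/
abbrev Config (d : ℕ) : Type := Site d → ℝ≥0

/-- Nearest neighbours: sites at `ℓ¹`-distance one; every site has `2 d` of them. -/
def Adj {d : ℕ} (x y : Site d) : Prop := ∑ i, |y i - x i| = 1

open Classical in
/-- The Zhang toppling at `x`: if `x` is unstable (height at least `1`), its whole mass is divided
equally among its `2 d` neighbours; if `x` is stable, nothing happens. -/
noncomputable def topple {d : ℕ} (x : Site d) (η : Config d) : Config d := fun y =>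
  if 1 ≤ η x then
    if y = x then 0 else if Adj x y then η y + η x / (2 * d) else η y
  else η y

/-! ### Poisson clocks -/

instance isProbabilityMeasure_expMeasure_one : IsProbabilityMeasure (expMeasure 1) :=
  isProbabilityMeasure_expMeasure one_pos

/-- The law of the clocks: `ω x n` is the waiting time at the site `x` between its ring number
`n - 1` (time `0` if `n = 0`) and its ring number `n`. All waiting times are independent and
exponential with rate `1`, so the ring times at the different sites are independent Poisson
processes of rate `1`. -/
noncomputable def clockLaw (d : ℕ) : Measure (Site d → ℕ → ℝ) :=
  Measure.infinitePi fun _ : Site d => Measure.infinitePi fun _ : ℕ => expMeasure 1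

instance isProbabilityMeasure_clockLaw (d : ℕ) : IsProbabilityMeasure (clockLaw d) := by
  unfold clockLaw; infer_instance

/-- The set of times at which the clock of `x` rings. -/
def rings {d : ℕ} (ω : Site d → ℕ → ℝ) (x : Site d) : Set ℝ :=
  Set.range fun n : ℕ => ∑ k ∈ Finset.range (n + 1), ω x k

/-! ### The Markov toppling process -/

/-- `ξ t` (for `t ≥ 0`) is the configuration at time `t` of the toppling process started from `η`
and driven by the clocks `ω`, and `pre t` (for `t > 0`) is the configuration just before time `t`.
The height at each site is a right-continuous step function of time; when the clock of `x` rings,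
the toppling at `x` is applied; nothing changes when no clock rings. (Almost surely no two clocks
ever ring at the same time, and each clock rings only finitely often in bounded time.) -/
structure IsTopplingProcess {d : ℕ} (ω : Site d → ℕ → ℝ) (η : Config d)
    (ξ pre : ℝ → Config d) : Prop where
  init : ξ 0 = η
  left_limit : ∀ t, 0 < t → ∀ x, ∀ᶠ s in 𝓝[<] t, ξ s x = pre t x
  right_cont : ∀ t, 0 ≤ t → ∀ x, ∀ᶠ s in 𝓝[>] t, ξ s x = ξ t x
  ring : ∀ t, 0 < t → ∀ x, t ∈ rings ω x → ξ t = topple x (pre t)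
  no_ring : ∀ t, 0 < t → (∀ x, t ∉ rings ω x) → ξ t = pre t

/-- The number of topplings at `x` up to and including time `t`: the rings of the clock of `x`
at which `x` is unstable. -/
noncomputable def topplingCount {d : ℕ} (ω : Site d → ℕ → ℝ) (pre : ℝ → Config d)
    (x : Site d) (t : ℝ) : ℕ∞ :=
  {s : ℝ | 0 < s ∧ s ≤ t ∧ s ∈ rings ω x ∧ 1 ≤ pre s x}.encard

/-- A configuration `η` is stabilizable if, almost surely, in the toppling process started from
`η` the number of topplings at every site has a finite limit as time tends to infinity (the number
is nondecreasing in time, so the limit is the supremum). For almost every `ω` there is exactly one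
such process on `[0, ∞)`. -/
def StabilizableConfig {d : ℕ} (η : Config d) : Prop :=
  ∀ᵐ ω ∂(clockLaw d), ∀ ξ pre : ℝ → Config d, IsTopplingProcess ω η ξ pre →
    ∀ x : Site d, (⨆ t : ℝ, topplingCount ω pre x t) < ⊤

/-- The set of all stabilizable configurations. -/
def stabilizableSet (d : ℕ) : Set (Config d) := {η | StabilizableConfig η}

/-- A probability measure on configurations is stabilizable if it gives mass one to the set of
stabilizable configurations. -/
def StabilizableMeasure {d : ℕ} (μ : Measure (Config d)) : Prop := μ (stabilizableSet d) = 1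

/-- `μ` is an ergodic measure of density `ρ`: a probability measure, invariant and ergodic under
the translations `η ↦ η (v + ·)`, `v ∈ ℤ^d`, for which the height at the origin has mean `ρ`. -/
structure IsErgodicWithDensity {d : ℕ} (μ : Measure (Config d)) (ρ : ℝ) : Prop where
  prob : IsProbabilityMeasure μ
  ergodic : ErgodicVAdd (Site d)ᵈᵃᵃ (Config d) μ
  density : ∫⁻ η, (η 0 : ℝ≥0∞) ∂μ = ENNReal.ofReal ρ

/-- The checkerboard: mass `m` on the sites with even coordinate sum, mass `0` on the others. -/
def checkerboard (d : ℕ) (m : ℝ≥0) : Config d := fun x => if Even (∑ i, x i) then m else 0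

end ZhangSandpile

/-! The measure is uniform on the translates of a periodic configuration: height `a` where the
coordinate sum lies in one class mod `N`, height `b` elsewhere. It lives on a single finite orbit of
the translations, hence is ergodic.

Instability has two ingredients. First, every site topples at least once. The sites of height `a ≥
1` do so at a ring of their own clock. In the checkerboard (`N = 2`) an empty site receives at least
`1/(2d)` from each of its `2d` neighbours; if `b ≥ 1 - 1/(2d)`, one toppling neighbour suffices and
topplings spread from layer to layer.

Second (`IsEmission.exists_infinite`), if all sites toppled but only finitely often, some site's
last toppling would precede those of all its neighbours. That toppling empties the site, the
neighbours then return at least `2d · 1/(2d) = 1`, and the site must topple again.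

Choosing that site requires the causal order of rings to be well-founded (`ae_typicalClocks`). An
infinite descending chain has times converging to some `τ`; loop erasure turns its tail into an
infinite self-avoiding path of sites ringing in one short window, which a subcritical path count
excludes. The same well-foundedness yields a toppling process by recursion on the mass emitted at
each ring. Such a process is needed because stabilizability quantifies over all processes. -/

namespace ZhangSandpile

/-! ### Renewal estimates for exponential waiting times -/

/-- The ring times of a clock with waiting times `u`. -/
def ringTime (u : ℕ → ℝ) (n : ℕ) : ℝ := ∑ k ∈ Finset.range (n + 1), u k

/-- The law of the waiting times of a single clock. -/
noncomputable def waitLaw : Measure (ℕ → ℝ) := Measure.infinitePi fun _ : ℕ => expMeasure 1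

instance isProbabilityMeasure_waitLaw : IsProbabilityMeasure waitLaw := by
  unfold waitLaw; infer_instance

@[fun_prop]
lemma measurable_ringTime (n : ℕ) : Measurable fun u : ℕ → ℝ => ringTime u n := by
  unfold ringTime; fun_prop

lemma expMeasure_one_le_volume (s : Set ℝ) : expMeasure 1 s ≤ volume s := by
  unfold expMeasure gammaMeasure
  rw [withDensity_apply' _ s]
  calc ∫⁻ x in s, gammaPDF 1 1 x ≤ ∫⁻ _ in s, 1 := by
        refine lintegral_mono fun x => ?_
        change exponentialPDF 1 x ≤ 1
        rw [exponentialPDF_eq]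
        refine ENNReal.ofReal_le_one.2 ?_
        split_ifs with h
        · simpa using h
        · exact zero_le_one
    _ = volume s := by simp

lemma expMeasure_one_Iic (t : ℝ) :
    expMeasure 1 (Set.Iic t) = ENNReal.ofReal (if 0 ≤ t then 1 - Real.exp (-t) else 0) := by
  have h := cdf_expMeasure_eq one_pos t
  rw [← ofReal_cdf, h]
  simp

lemma expMeasure_one_Iic_zero : expMeasure 1 (Set.Iic 0) = 0 := by
  simp [expMeasure_one_Iic]

lemma expMeasure_one_Iic_lt_one (t : ℝ) : expMeasure 1 (Set.Iic t) < 1 := by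
  rw [expMeasure_one_Iic]
  refine ENNReal.ofReal_lt_one.2 ?_
  split_ifs
  · linarith [Real.exp_pos (-t)]
  · exact zero_lt_one

/-- Condition on `X` and use Fubini. This serves both to bound the law of a ring time, a sum of
independent waiting times, and, with a window of length zero, to exclude simultaneous rings. -/
lemma measure_sub_mem_Icc_le {Ω : Type*} [MeasurableSpace Ω] {P : Measure Ω}
    [IsProbabilityMeasure P] {X Y : Ω → ℝ} (hX : Measurable X) (hY : Measurable Y)
    (hXY : IndepFun X Y P) {a b : ℝ} {δ : ℝ≥0∞}
    (h : ∀ c, P {ω | Y ω ∈ Set.Icc (a + c) (b + c)} ≤ δ) :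
    P {ω | Y ω - X ω ∈ Set.Icc a b} ≤ δ := by
  have hmap := (indepFun_iff_map_prod_eq_prod_map_map hX.aemeasurable hY.aemeasurable).1 hXY
  have : IsProbabilityMeasure (P.map X) := Measure.isProbabilityMeasure_map hX.aemeasurable
  have : IsProbabilityMeasure (P.map Y) := Measure.isProbabilityMeasure_map hY.aemeasurable
  have hs : MeasurableSet {p : ℝ × ℝ | p.2 - p.1 ∈ Set.Icc a b} :=
    (measurable_snd.sub measurable_fst) measurableSet_Icc
  have h1 : P {ω | Y ω - X ω ∈ Set.Icc a b}
      = P.map (fun ω => (X ω, Y ω)) {p : ℝ × ℝ | p.2 - p.1 ∈ Set.Icc a b} := by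
    rw [Measure.map_apply (hX.prodMk hY) hs]; rfl
  rw [h1, hmap, Measure.prod_apply hs]
  calc ∫⁻ x, P.map Y (Prod.mk x ⁻¹' {p : ℝ × ℝ | p.2 - p.1 ∈ Set.Icc a b}) ∂(P.map X)
      ≤ ∫⁻ _, δ ∂(P.map X) := by
        refine lintegral_mono fun x => ?_
        rw [Measure.map_apply hY (measurable_prodMk_left hs)]
        refine le_trans (measure_mono fun ω hω => ?_) (h x)
        simp only [Set.mem_preimage, Set.mem_ofPred_eq, Set.mem_Icc] at hω ⊢
        constructor <;> linarith [hω.1, hω.2]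
    _ = δ := by simp

lemma waitLaw_eval (k : ℕ) {s : Set ℝ} (hs : MeasurableSet s) :
    waitLaw {u | u k ∈ s} = expMeasure 1 s :=
  (measurePreserving_eval_infinitePi (fun _ : ℕ => expMeasure 1) k).measure_preimage
    hs.nullMeasurableSet

lemma ae_waitLaw_pos : ∀ᵐ u ∂waitLaw, ∀ k, 0 < u k := by
  refine ae_all_iff.2 fun k => ?_
  have h := waitLaw_eval k (measurableSet_Iic (a := (0 : ℝ)))
  rw [expMeasure_one_Iic_zero] at h
  rw [ae_iff]
  simpa using h

lemma waitLaw_ringTime_mem_Icc_le (n : ℕ) (a b : ℝ) :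
    waitLaw {u | ringTime u n ∈ Set.Icc a b} ≤ ENNReal.ofReal (b - a) := by
  have hind : iIndepFun (fun (k : ℕ) (u : ℕ → ℝ) => u k) waitLaw :=
    iIndepFun_infinitePi (P := fun _ : ℕ => expMeasure 1) (X := fun _ : ℕ => id)
      fun _ => measurable_id
  -- The earlier waiting times enter negated, so that the difference in `measure_sub_mem_Icc_le`
  -- becomes the full sum; the last waiting time has density at most `1`.
  have h1 := (hind.indepFun_finsetSum_of_notMem (fun k => measurable_pi_apply k)
    (s := Finset.range n) (i := n) (by simp)).comp measurable_neg measurable_id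
  have h2 := measure_sub_mem_Icc_le (a := a) (b := b) (δ := ENNReal.ofReal (b - a))
    (by fun_prop) (by fun_prop) h1 fun c => by
      refine (waitLaw_eval n measurableSet_Icc).trans_le ((expMeasure_one_le_volume _).trans ?_)
      simp
  refine le_trans (measure_mono fun u hu => ?_) h2
  simp only [ringTime, Finset.sum_range_succ, Set.mem_ofPred_eq] at hu
  simpa [add_comm] using hu

lemma waitLaw_forall_le (t : ℝ) (N : ℕ) :
    waitLaw {u | ∀ k < N, u k ≤ t} = expMeasure 1 (Set.Iic t) ^ N := by
  have h := Measure.infinitePi_pi (fun _ : ℕ => expMeasure 1) (s := Finset.range N)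
    (t := fun _ => Set.Iic t) fun _ _ => measurableSet_Iic
  simp only [Finset.prod_const, Finset.card_range] at h
  rw [← h]
  unfold waitLaw
  congr 1
  ext u
  simp [Set.mem_pi]

lemma le_ringTime {u : ℕ → ℝ} (hu : ∀ k, 0 < u k) {k n : ℕ} (h : k ≤ n) : u k ≤ ringTime u n :=
  Finset.single_le_sum (f := u) (fun i _ => (hu i).le) (by simpa using Nat.lt_succ_of_le h)

lemma ringTime_strictMono {u : ℕ → ℝ} (hu : ∀ k, 0 < u k) : StrictMono (ringTime u) :=
  strictMono_nat_of_lt_succ fun n => by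
    simp only [ringTime, Finset.sum_range_succ _ (n + 1)]
    linarith [hu (n + 1)]

lemma ringTime_pos {u : ℕ → ℝ} (hu : ∀ k, 0 < u k) (n : ℕ) : 0 < ringTime u n :=
  (hu 0).trans_le (le_ringTime hu (Nat.zero_le n))

/-- Almost surely the waiting times are unbounded, and a single one exceeding `K` already pushes the
ring times beyond `K`. -/
lemma ae_waitLaw_tendsto : ∀ᵐ u ∂waitLaw, Tendsto (ringTime u) atTop atTop := by
  have key : ∀ K : ℕ, ∀ᵐ u : ℕ → ℝ ∂waitLaw, ¬ ∀ k, u k ≤ (K : ℝ) := by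
    intro K
    rw [ae_iff]
    have hlim := ENNReal.tendsto_pow_atTop_nhds_zero_of_lt_one (expMeasure_one_Iic_lt_one K)
    refine le_antisymm (ge_of_tendsto' hlim fun N => ?_) zero_le
    rw [← waitLaw_forall_le]
    exact measure_mono fun u hu k _ => by simp at hu; exact hu k
  filter_upwards [ae_waitLaw_pos, ae_all_iff.2 key] with u hu hk
  refine tendsto_atTop_atTop_of_monotone (ringTime_strictMono hu).monotone fun t => ?_
  obtain ⟨K, hK⟩ := exists_nat_ge t
  have := hk K
  push Not at this
  obtain ⟨k, hk⟩ := this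
  exact ⟨k, hK.trans (hk.le.trans (le_ringTime hu le_rfl))⟩

/-- The waiting times for which the clock rings during `[a, b]`. -/
def ringsIn (a b : ℝ) : Set (ℕ → ℝ) := {u | ∃ n, ringTime u n ∈ Set.Icc a b}

lemma measurableSet_ringsIn (a b : ℝ) : MeasurableSet (ringsIn a b) := by
  have : ringsIn a b = ⋃ n, (fun u => ringTime u n) ⁻¹' Set.Icc a b := by
    ext u; simp [ringsIn]
  rw [this]
  exact MeasurableSet.iUnion fun n => measurable_ringTime n measurableSet_Icc

/-- The first `N` rings are handled by a union bound; a later ring before time `K` forces the first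
`N` waiting times to be at most `K`. -/
lemma waitLaw_ringsIn_le (N : ℕ) {a b K : ℝ} (hb : b ≤ K) :
    waitLaw (ringsIn a b) ≤ N * ENNReal.ofReal (b - a) + expMeasure 1 (Set.Iic K) ^ N := by
  have hsub : ringsIn a b ⊆ ((⋃ n ∈ Finset.range N, {u | ringTime u n ∈ Set.Icc a b}) ∪
      {u | ∀ k < N, u k ≤ K}) ∪ {u | ¬ ∀ k, 0 < u k} := by
    rintro u ⟨n, hn⟩
    by_cases hu : ∀ k, 0 < u k
    · left
      by_cases hnN : n < N
      · left
        simp only [Set.mem_iUnion]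
        exact ⟨n, by simpa using hnN, hn⟩
      · right
        intro k hk
        exact (le_ringTime hu (by omega)).trans (hn.2.trans hb)
    · right; exact hu
  refine (measure_mono hsub).trans ((measure_union_le _ _).trans ?_)
  rw [ae_iff.1 ae_waitLaw_pos, add_zero]
  refine (measure_union_le _ _).trans (add_le_add ?_ (waitLaw_forall_le K N).le)
  refine (measure_biUnion_finset_le _ _).trans ?_
  refine (Finset.sum_le_sum fun n _ => waitLaw_ringTime_mem_Icc_le n a b).trans ?_
  simp

/-- Rings during short windows in a bounded time interval are uniformly unlikely. -/
lemma exists_waitLaw_ringsIn_le (K : ℝ) {δ : ℝ≥0∞} (hδ : δ ≠ 0) :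
    ∃ M : ℕ, 0 < M ∧ ∀ a b : ℝ, b ≤ K → b - a ≤ 1 / M → waitLaw (ringsIn a b) ≤ δ := by
  have hδ2 : 0 < δ / 2 := ENNReal.half_pos hδ
  have h1 := ENNReal.tendsto_pow_atTop_nhds_zero_of_lt_one (expMeasure_one_Iic_lt_one K)
  -- `N` is fixed first, to make the tail small; only then is the window length `1 / M` chosen, in
  -- terms of `N`.
  obtain ⟨N, hN⟩ := (h1.eventually (gt_mem_nhds hδ2)).exists
  have h2 : Tendsto (fun M : ℕ => (N : ℝ≥0∞) * ENNReal.ofReal (1 / M)) atTop (𝓝 0) := by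
    have := ENNReal.Tendsto.const_mul (a := (N : ℝ≥0∞))
      (ENNReal.tendsto_ofReal tendsto_one_div_atTop_nhds_zero_nat)
      (Or.inr (ENNReal.natCast_ne_top N))
    simpa using this
  obtain ⟨M, hM, hM0⟩ := ((h2.eventually (gt_mem_nhds hδ2)).and (eventually_gt_atTop 0)).exists
  refine ⟨M, hM0, fun a b hb hab => (waitLaw_ringsIn_le N hb).trans ?_⟩
  calc (N : ℝ≥0∞) * ENNReal.ofReal (b - a) + expMeasure 1 (Set.Iic K) ^ N
      ≤ N * ENNReal.ofReal (1 / M) + δ / 2 := by gcongr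
    _ ≤ δ / 2 + δ / 2 := by gcongr
    _ = δ := ENNReal.add_halves δ

/-! ### Almost sure properties of the clocks -/

lemma measurePreserving_clockLaw_eval {d : ℕ} (x : Site d) :
    MeasurePreserving (fun ω : Site d → ℕ → ℝ => ω x) (clockLaw d) waitLaw :=
  measurePreserving_eval_infinitePi (fun _ : Site d => waitLaw) x

lemma ae_clockLaw_ringTime_ne {d : ℕ} : ∀ᵐ ω ∂clockLaw d, ∀ x y : Site d, x ≠ y →
    ∀ n m, ringTime (ω x) n ≠ ringTime (ω y) m := by
  refine ae_all_iff.2 fun x => ae_all_iff.2 fun y => ?_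
  by_cases hxy : x = y
  · simp [hxy]
  refine (ae_all_iff.2 fun n => ae_all_iff.2 fun m => ?_ :
    ∀ᵐ ω ∂clockLaw d, ∀ n m, ringTime (ω x) n ≠ ringTime (ω y) m).mono fun ω h _ => h
  have hind : iIndepFun (fun (z : Site d) (ω : Site d → ℕ → ℝ) => ω z) (clockLaw d) :=
    iIndepFun_infinitePi (P := fun _ : Site d => waitLaw) (X := fun _ => id)
      fun _ => measurable_id
  have h1 := (hind.indepFun hxy).comp (measurable_ringTime n) (measurable_ringTime m)
  have h2 := measure_sub_mem_Icc_le (a := 0) (b := 0) (δ := 0) (by fun_prop) (by fun_prop) h1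
    fun c => by
      have := (measurePreserving_clockLaw_eval y).measure_preimage
        (measurable_ringTime m measurableSet_Icc :
          MeasurableSet {u | ringTime u m ∈ Set.Icc (0 + c) (0 + c)}).nullMeasurableSet
      refine this.trans_le ((waitLaw_ringTime_mem_Icc_le m _ _).trans ?_)
      simp
  rw [ae_iff]
  refine le_antisymm (le_trans (measure_mono fun ω hω => ?_) h2) zero_le
  simp only [ne_eq, not_not, Set.mem_ofPred_eq] at hω
  simp [hω]

lemma clockLaw_forall_mem {d : ℕ} (S : Finset (Site d)) {O : Set (ℕ → ℝ)}
    (hO : MeasurableSet O) : clockLaw d {ω | ∀ z ∈ S, ω z ∈ O} = waitLaw O ^ S.card := by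
  have h := Measure.infinitePi_pi (fun _ : Site d => waitLaw) (s := S) (t := fun _ => O)
    fun _ _ => hO
  rw [Finset.prod_const] at h
  exact h

/-- A finite family of pairs (visited sites, endpoint) that contains all those coming from paths of
length `k` from `x` with steps in `D`. -/
def traces {d : ℕ} (D : Finset (Site d)) (x : Site d) : ℕ → Finset (Finset (Site d) × Site d)
  | 0 => {({x}, x)}
  | k + 1 => (traces D x k ×ˢ D).image fun p => (insert (p.1.2 + p.2) p.1.1, p.1.2 + p.2)

lemma card_traces_le {d : ℕ} (D : Finset (Site d)) (x : Site d) (k : ℕ) :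
    (traces D x k).card ≤ D.card ^ k := by
  induction k with
  | zero => simp [traces]
  | succ k ih =>
    refine Finset.card_image_le.trans ?_
    rw [Finset.card_product, pow_succ]
    gcongr

lemma mem_traces {d : ℕ} {D : Finset (Site d)} {y : ℕ → Site d}
    (hy : ∀ i, y (i + 1) - y i ∈ D) (k : ℕ) :
    ((Finset.range (k + 1)).image y, y k) ∈ traces D (y 0) k := by
  induction k with
  | zero => simp [traces]
  | succ k ih =>
    refine Finset.mem_image.2 ⟨(((Finset.range (k + 1)).image y, y k), y (k + 1) - y k),
      Finset.mem_product.2 ⟨ih, hy k⟩, ?_⟩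
    rw [Finset.range_add_one (n := k + 1), Finset.image_insert]
    simp

/-- Infinite self-avoiding paths of sites whose clocks ring in a short window do not exist. -/
lemma ae_not_exists_path {d : ℕ} (D : Finset (Site d)) {O : Set (ℕ → ℝ)} (hO : MeasurableSet O)
    (hp : waitLaw O * D.card < 1) (x : Site d) :
    ∀ᵐ ω ∂clockLaw d, ¬ ∃ y : ℕ → Site d, y 0 = x ∧ Function.Injective y ∧
      (∀ i, y (i + 1) - y i ∈ D) ∧ ∀ i, ω (y i) ∈ O := by
  rw [ae_iff]
  have hlim := ENNReal.tendsto_pow_atTop_nhds_zero_of_lt_one hp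
  refine le_antisymm (ge_of_tendsto' hlim fun k => ?_) zero_le
  -- A self-avoiding path visits `k + 1` distinct sites in its first `k` steps, so independence
  -- applies to its trace; there are at most `D.card ^ k` traces.
  have hsub : {ω : Site d → ℕ → ℝ | ¬ ¬ ∃ y : ℕ → Site d, y 0 = x ∧ Function.Injective y ∧
      (∀ i, y (i + 1) - y i ∈ D) ∧ ∀ i, ω (y i) ∈ O} ⊆
      ⋃ p ∈ (traces D x k).filter (fun p => p.1.card = k + 1), {ω | ∀ z ∈ p.1, ω z ∈ O} := by
    intro ω hω
    simp only [not_not, Set.mem_ofPred_eq] at hω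
    obtain ⟨y, rfl, hinj, hstep, hopen⟩ := hω
    simp only [Set.mem_iUnion]
    refine ⟨((Finset.range (k + 1)).image y, y k), Finset.mem_filter.2 ⟨mem_traces hstep k, ?_⟩, ?_⟩
    · rw [Finset.card_image_of_injective _ hinj, Finset.card_range]
    · intro z hz
      obtain ⟨i, -, rfl⟩ := Finset.mem_image.1 hz
      exact hopen i
  refine (measure_mono hsub).trans ((measure_biUnion_finset_le _ _).trans ?_)
  calc ∑ p ∈ (traces D x k).filter (fun p => p.1.card = k + 1),
        clockLaw d {ω | ∀ z ∈ p.1, ω z ∈ O}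
      ≤ ∑ p ∈ (traces D x k).filter (fun p => p.1.card = k + 1), waitLaw O ^ k := by
        refine Finset.sum_le_sum fun p hp => ?_
        rw [clockLaw_forall_mem _ hO, (Finset.mem_filter.1 hp).2]
        exact pow_le_pow_right_of_le_one' prob_le_one (Nat.le_succ k)
    _ = ((traces D x k).filter (fun p => p.1.card = k + 1)).card * waitLaw O ^ k := by simp
    _ ≤ (D.card ^ k : ℕ) * waitLaw O ^ k := by
        gcongr
        exact (Finset.card_filter_le _ _).trans (card_traces_le D x k)
    _ = (waitLaw O * D.card) ^ k := by push_cast; rw [mul_pow, mul_comm]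


/-! ### The causal order of the rings is almost surely well-founded -/

/-- Loop erasure of a sequence that visits every point finitely often. -/
lemma exists_injective_subsequence {α : Type*} {x : ℕ → α} {R : α → α → Prop}
    (h : ∀ i, x (i + 1) = x i ∨ R (x i) (x (i + 1))) (hfin : ∀ z, {i | x i = z}.Finite) :
    ∃ p : ℕ → ℕ, x (p 0) = x 0 ∧ Function.Injective (x ∘ p) ∧
      ∀ i, R (x (p i)) (x (p (i + 1))) := by
  have hlast : ∀ i, ∃ l, x l = x i ∧ ∀ j, x j = x i → j ≤ l := fun i => by
    obtain ⟨l, hl, hmax⟩ := Set.exists_max_image _ id (hfin (x i)) ⟨i, rfl⟩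
    exact ⟨l, hl, hmax⟩
  choose l hl hmax using hlast
  -- From the last visit to a point, take one step and jump to the last visit of the point reached.
  let p : ℕ → ℕ := fun n => Nat.rec (l 0) (fun _ q => l (q + 1)) n
  have hsucc : ∀ m, p (m + 1) = l (p m + 1) := fun m => rfl
  have hp : ∀ m j, x j = x (p m) → j ≤ p m := by
    rintro (_ | m) j hj
    · exact hmax 0 j (hj.trans (hl 0))
    · rw [hsucc] at hj ⊢
      exact hmax _ j (hj.trans (hl _))
  have hmono : StrictMono p := strictMono_nat_of_lt_succ fun m => by
    rw [hsucc]; exact hmax (p m + 1) (p m + 1) rfl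
  refine ⟨p, hl 0, fun m m' hm => ?_, fun m => ?_⟩
  · exact hmono.injective (le_antisymm (hp m' _ hm) (hp m _ hm.symm))
  · rw [hsucc, hl]
    refine (h (p m)).resolve_left fun heq => ?_
    exact absurd (hp m _ heq) (by omega)

/-- The ring `e` (number `e.2` at the site `e.1`) happens before the ring `e'`, at the same site or
at a neighbour. -/
def Precedes {d : ℕ} (ω : Site d → ℕ → ℝ) (e e' : Site d × ℕ) : Prop :=
  ringTime (ω e.1) e.2 < ringTime (ω e'.1) e'.2 ∧ (e.1 = e'.1 ∨ Adj e'.1 e.1)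

/-- The properties of typical clocks on which the construction of the process relies. -/
structure TypicalClocks {d : ℕ} (ω : Site d → ℕ → ℝ) : Prop where
  pos : ∀ x k, 0 < ω x k
  tendsto : ∀ x, Tendsto (ringTime (ω x)) atTop atTop
  ne : ∀ x y, x ≠ y → ∀ n m, ringTime (ω x) n ≠ ringTime (ω y) m
  wf : WellFounded (Precedes ω)

lemma Adj.abs_sub_le {d : ℕ} {x y : Site d} (h : Adj x y) (i : Fin d) : |y i - x i| ≤ 1 :=
  (Finset.single_le_sum (f := fun i => |y i - x i|) (fun _ _ => abs_nonneg _)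
    (Finset.mem_univ i)).trans_eq h

lemma Adj.sub_mem_Icc {d : ℕ} {x y : Site d} (h : Adj x y) :
    y - x ∈ Finset.Icc (-1 : Site d) 1 := by
  rw [Finset.mem_Icc, Pi.le_def, Pi.le_def]
  exact ⟨fun i => (abs_le.1 (h.abs_sub_le i)).1, fun i => (abs_le.1 (h.abs_sub_le i)).2⟩

lemma finite_ringTime_le {u : ℕ → ℝ} (h : Tendsto (ringTime u) atTop atTop) (t : ℝ) :
    {n | ringTime u n ≤ t}.Finite := by
  have := h.eventually_gt_atTop t
  rw [← Nat.cofinite_eq_atTop, eventually_cofinite] at this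
  simpa using this

/-- Absence of infinite self-avoiding paths of rings in short windows implies that the causal order
is well-founded. -/
lemma wellFounded_precedes {d : ℕ} {ω : Site d → ℕ → ℝ} (hpos : ∀ x k, 0 < ω x k)
    (htend : ∀ x, Tendsto (ringTime (ω x)) atTop atTop) {M : ℕ → ℕ} (hM : ∀ K, 0 < M K)
    (hpath : ∀ K j : ℕ, ((j : ℝ) + 1) / M K ≤ K → ∀ x, ¬ ∃ y : ℕ → Site d, y 0 = x ∧
      Function.Injective y ∧ (∀ i, y (i + 1) - y i ∈ Finset.Icc (-1 : Site d) 1) ∧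
      ∀ i, ω (y i) ∈ ringsIn ((j : ℝ) / M K) (((j : ℝ) + 1) / M K)) :
    WellFounded (Precedes ω) := by
  rw [wellFounded_iff_isEmpty_descending_chain]
  refine ⟨fun ⟨e, he⟩ => ?_⟩
  set T : ℕ → ℝ := fun i => ringTime (ω (e i).1) (e i).2 with hT
  have hanti : StrictAnti T := strictAnti_nat_of_succ_lt fun i => (he i).1
  have hT0 : ∀ i, 0 < T i := fun i => ringTime_pos (hpos _) _
  have hlim : Tendsto T atTop (𝓝 (⨅ i, T i)) :=
    tendsto_atTop_ciInf hanti.antitone ⟨0, by rintro _ ⟨i, rfl⟩; exact (hT0 i).le⟩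
  set τ := ⨅ i, T i
  have hτ0 : 0 ≤ τ := ge_of_tendsto' hlim fun i => (hT0 i).le
  have hτ : ∀ i, τ ≤ T i := fun i => hanti.antitone.le_of_tendsto hlim i
  obtain ⟨K, hK⟩ := exists_nat_ge (τ + 1)
  have hM0 : (0 : ℝ) < M K := by exact_mod_cast hM K
  have hM1 : (1 : ℝ) ≤ M K := by exact_mod_cast hM K
  -- The grid window of mesh `1 / M K` containing the limit `τ`. The grid makes the windows
  -- countable, and `τ + 1 ≤ K` keeps this one below `K`.
  set j := ⌊τ * M K⌋₊
  have ha : (j : ℝ) / M K ≤ τ := by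
    rw [div_le_iff₀ hM0]; exact Nat.floor_le (by positivity)
  have hb : τ < ((j : ℝ) + 1) / M K := by
    rw [lt_div_iff₀ hM0]; exact Nat.lt_floor_add_one _
  have hbK : ((j : ℝ) + 1) / M K ≤ K := by
    rw [add_div]
    have : 1 / (M K : ℝ) ≤ 1 := (div_le_one hM0).2 hM1
    linarith
  obtain ⟨i₀, hi₀⟩ := (hlim.eventually (gt_mem_nhds hb)).exists
  have hTb : ∀ i, T (i₀ + i) ≤ ((j : ℝ) + 1) / M K := fun i =>
    (hanti.antitone (Nat.le_add_right _ _)).trans hi₀.le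
  -- Each site is visited finitely often: it has finitely many rings before the window ends, and no
  -- ring occurs twice in the chain.
  obtain ⟨p, -, hinj, hadj⟩ := exists_injective_subsequence (x := fun i => (e (i₀ + i)).1)
    (R := Adj) (fun i => (he (i₀ + i)).2) fun z => by
      refine Set.Finite.of_finite_image (f := fun i => (e (i₀ + i)).2) ?_ ?_
      · refine (finite_ringTime_le (htend z) (((j : ℝ) + 1) / M K)).subset ?_
        rintro _ ⟨i, hi, rfl⟩
        have := hTb i
        simp only [hT, Set.mem_ofPred_eq] at this hi ⊢
        rwa [hi] at this
      · intro i hi i' hi' hii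
        simp only [Set.mem_ofPred_eq] at hi hi' hii
        have : T (i₀ + i) = T (i₀ + i') := by
          simp only [hT, hi, hi', hii]
        exact Nat.add_left_cancel (hanti.injective this)
  exact hpath K j hbK _ ⟨fun i => (e (i₀ + p i)).1, rfl, hinj, fun i => (hadj i).sub_mem_Icc,
    fun i => ⟨_, ha.trans (hτ _), hTb _⟩⟩

theorem ae_typicalClocks (d : ℕ) : ∀ᵐ ω ∂clockLaw d, TypicalClocks ω := by
  set D : Finset (Site d) := Finset.Icc (-1) 1
  have hD : (D.card : ℝ≥0∞) ≠ 0 := by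
    have : (0 : Site d) ∈ D := by
      simp only [D, Finset.mem_Icc, Pi.le_def]
      exact ⟨fun _ => by simp, fun _ => by simp⟩
    exact_mod_cast (Finset.card_pos.2 ⟨0, this⟩).ne'
  -- With this bound on the ring probability, the expected number of paths shrinks by at least a
  -- factor `1/2` per step.
  have hδ : (2 * (D.card : ℝ≥0∞))⁻¹ ≠ 0 :=
    ENNReal.inv_ne_zero.2 (ENNReal.mul_ne_top (by simp) (by simp))
  choose M hM hMb using fun K : ℕ => exists_waitLaw_ringsIn_le (K : ℝ) hδ
  have hpath : ∀ᵐ ω ∂clockLaw d, ∀ K j : ℕ, ((j : ℝ) + 1) / M K ≤ K → ∀ x,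
      ¬ ∃ y : ℕ → Site d, y 0 = x ∧
      Function.Injective y ∧ (∀ i, y (i + 1) - y i ∈ D) ∧
      ∀ i, ω (y i) ∈ ringsIn ((j : ℝ) / M K) (((j : ℝ) + 1) / M K) := by
    refine ae_all_iff.2 fun K => ae_all_iff.2 fun j => ?_
    by_cases hjK : ((j : ℝ) + 1) / M K ≤ K
    swap
    · simp [hjK]
    refine (ae_all_iff.2 fun x => ae_not_exists_path D (measurableSet_ringsIn _ _) ?_ x).mono
      fun ω h _ => h
    have h1 := hMb K ((j : ℝ) / M K) (((j : ℝ) + 1) / M K) hjK (by rw [add_div]; linarith)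
    calc _ ≤ (2 * (D.card : ℝ≥0∞))⁻¹ * D.card := by gcongr
      _ = 2⁻¹ := by
        rw [ENNReal.mul_inv (by simp) (by simp), mul_assoc,
          ENNReal.inv_mul_cancel hD (by simp), mul_one]
      _ < 1 := by simp
  have hpos : ∀ᵐ ω ∂clockLaw d, ∀ x k, 0 < ω x k := ae_all_iff.2 fun x =>
    (measurePreserving_clockLaw_eval x).quasiMeasurePreserving.ae ae_waitLaw_pos
  have htend : ∀ᵐ ω ∂clockLaw d, ∀ x, Tendsto (ringTime (ω x)) atTop atTop :=
    ae_all_iff.2 fun x =>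
      (measurePreserving_clockLaw_eval x).quasiMeasurePreserving.ae ae_waitLaw_tendsto
  filter_upwards [hpos, htend, ae_clockLaw_ringTime_ne, hpath] with ω h1 h2 h3 h4
  exact ⟨h1, h2, h3, wellFounded_precedes h1 h2 hM h4⟩


/-! ### Neighbours -/

lemma adj_comm {d : ℕ} {x y : Site d} : Adj x y ↔ Adj y x := by
  simp only [Adj, abs_sub_comm]

lemma not_adj_self {d : ℕ} (x : Site d) : ¬ Adj x x := by
  simp [Adj]

open Classical in
/-- The finite set of neighbours of a site. -/
noncomputable def nbrs {d : ℕ} (x : Site d) : Finset (Site d) :=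
  ((Finset.Icc (-1 : Site d) 1).image (x + ·)).filter (Adj x)

lemma mem_nbrs {d : ℕ} {x y : Site d} : y ∈ nbrs x ↔ Adj x y := by
  simp only [nbrs, Finset.mem_filter, Finset.mem_image, and_iff_right_iff_imp]
  exact fun h => ⟨y - x, h.sub_mem_Icc, by simp⟩

lemma adj_add_single {d : ℕ} (x : Site d) (i : Fin d) {s : ℤ} (hs : |s| = 1) :
    Adj x (x + Pi.single i s) := by
  unfold Adj
  rw [Finset.sum_eq_single i]
  · simpa using hs
  · intro j _ hj
    simp [Pi.single_eq_of_ne hj]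
  · simp

lemma two_mul_le_card_nbrs {d : ℕ} (x : Site d) : 2 * d ≤ (nbrs x).card := by
  let sgn : Bool → ℤ := fun b => if b then 1 else -1
  have hsgn : ∀ b, |sgn b| = 1 := by decide
  let f : Bool × Fin d → Site d := fun p => x + Pi.single p.2 (sgn p.1)
  have hinj : Function.Injective f := by
    rintro ⟨b, i⟩ ⟨c, j⟩ h
    have h1 : (Pi.single i (sgn b) : Site d) i = (Pi.single j (sgn c) : Site d) i :=
      congrFun (add_left_cancel h) i
    by_cases hij : i = j
    · subst hij
      rw [Pi.single_eq_same, Pi.single_eq_same] at h1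
      have hbc : ∀ b c, sgn b = sgn c → b = c := by decide
      rw [hbc b c h1]
    · rw [Pi.single_eq_same, Pi.single_eq_of_ne hij] at h1
      have := hsgn b
      simp [h1] at this
  have h := Finset.card_le_card_of_injOn (s := Finset.univ) (t := nbrs x) f
    (fun p _ => mem_nbrs.2 (adj_add_single x p.2 (hsgn p.1))) hinj.injOn
  rwa [Finset.card_univ, Fintype.card_prod, Fintype.card_bool, Fintype.card_fin] at h

/-! ### Heights as functions of the emitted masses -/

/-- The total mass emitted by `x` at the rings with times in `I`, if `a e` is the mass emitted at
the ring `e`. -/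
noncomputable def emitted {d : ℕ} (ω : Site d → ℕ → ℝ) (a : Site d × ℕ → ℝ) (x : Site d)
    (I : Set ℝ) : ℝ :=
  ∑ᶠ n ∈ ringTime (ω x) ⁻¹' I, a (x, n)

/-- The height at `x` after the rings with times in `I`. -/
noncomputable def height {d : ℕ} (ω : Site d → ℕ → ℝ) (η : Config d) (a : Site d × ℕ → ℝ)
    (x : Site d) (I : Set ℝ) : ℝ :=
  η x + (∑ y ∈ nbrs x, emitted ω a y I) / (2 * d) - emitted ω a x I

/-- Whether the site of the ring `e` is unstable just before this ring. -/
def Topples {d : ℕ} (ω : Site d → ℕ → ℝ) (η : Config d) (a : Site d × ℕ → ℝ)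
    (e : Site d × ℕ) : Prop :=
  1 ≤ height ω η a e.1 (Set.Iio (ringTime (ω e.1) e.2))

/-- `a` is consistent with the toppling rule. -/
structure IsEmission {d : ℕ} (ω : Site d → ℕ → ℝ) (η : Config d) (a : Site d × ℕ → ℝ) :
    Prop where
  eq_height : ∀ {e}, Topples ω η a e → a e = height ω η a e.1 (Set.Iio (ringTime (ω e.1) e.2))
  eq_zero : ∀ {e}, ¬ Topples ω η a e → a e = 0

lemma exists_eq_of_wellFounded {α β : Type*} [Inhabited β] {r : α → α → Prop}
    (hr : WellFounded r) (G : (α → β) → α → β)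
    (hG : ∀ f g e, (∀ e', r e' e → f e' = g e') → G f e = G g e) : ∃ f, ∀ e, f e = G f e := by
  classical
  -- The default value is harmless: by `hG` only predecessors of `e` matter.
  refine ⟨hr.fix fun e rec => G (fun e' => if h : r e' e then rec e' h else default) e,
    fun e => ?_⟩
  rw [hr.fix_eq]
  refine hG _ _ e fun e' he' => ?_
  rw [dif_pos he']

section

variable {d : ℕ} {ω : Site d → ℕ → ℝ} {η : Config d} {a b : Site d × ℕ → ℝ}

lemma emitted_congr_fun {x : Site d} {I : Set ℝ}
    (h : ∀ n, ringTime (ω x) n ∈ I → a (x, n) = b (x, n)) :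
    emitted ω a x I = emitted ω b x I :=
  finsum_mem_congr rfl h

lemma height_congr_fun {x : Site d} {I : Set ℝ}
    (h : ∀ y n, y = x ∨ Adj x y → ringTime (ω y) n ∈ I → a (y, n) = b (y, n)) :
    height ω η a x I = height ω η b x I := by
  unfold height
  rw [emitted_congr_fun fun n => h x n (Or.inl rfl),
    Finset.sum_congr rfl fun y hy => emitted_congr_fun fun n => h y n (Or.inr (mem_nbrs.1 hy))]

/-- The height just before a ring depends only on earlier rings at the site and its neighbours, so
the toppling rule is a well-founded recursion. -/
lemma TypicalClocks.exists_isEmission (hω : TypicalClocks ω) (η : Config d) :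
    ∃ a, IsEmission ω η a := by
  let φ : ℝ → ℝ := fun h => if 1 ≤ h then h else 0
  obtain ⟨a, ha⟩ := exists_eq_of_wellFounded hω.wf
    (fun a e => φ (height ω η a e.1 (Set.Iio (ringTime (ω e.1) e.2)))) fun f g e h =>
      congrArg φ (height_congr_fun fun y n hy hn => h (y, n) ⟨hn, hy.imp id id⟩)
  exact ⟨a, fun {e} he => (ha e).trans (if_pos he), fun {e} he => (ha e).trans (if_neg he)⟩

lemma IsEmission.one_le (ha : IsEmission ω η a) {e : Site d × ℕ} (h : Topples ω η a e) :
    1 ≤ a e := by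
  rw [ha.eq_height h]; exact h

lemma IsEmission.nonneg (ha : IsEmission ω η a) (e : Site d × ℕ) : 0 ≤ a e := by
  by_cases h : Topples ω η a e
  · exact zero_le_one.trans (ha.one_le h)
  · exact (ha.eq_zero h).ge

/-- This makes the `finsum` in `emitted` a genuine sum for bounded `I`; on infinite support it would
be `0`. -/
lemma TypicalClocks.finite_preimage (hω : TypicalClocks ω) {I : Set ℝ} (hI : BddAbove I)
    (x : Site d) : (ringTime (ω x) ⁻¹' I).Finite := by
  obtain ⟨t, ht⟩ := hI
  exact (finite_ringTime_le (hω.tendsto x) t).subset fun n hn => ht hn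

lemma emitted_nonneg (ha : ∀ e, 0 ≤ a e) (x : Site d) (I : Set ℝ) : 0 ≤ emitted ω a x I :=
  finsum_nonneg fun n => finsum_nonneg fun _ => ha (x, n)

lemma emitted_insert (hω : TypicalClocks ω) {I J : Set ℝ} (hI : BddAbove I) {x : Site d} {n : ℕ}
    (hn : ringTime (ω x) n ∉ I)
    (h : ringTime (ω x) ⁻¹' J = insert n (ringTime (ω x) ⁻¹' I)) :
    emitted ω a x J = a (x, n) + emitted ω a x I := by
  unfold emitted
  rw [h, finsum_mem_insert (fun n => a (x, n)) (Set.mem_preimage.not.2 hn) (hω.finite_preimage hI x)]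

lemma emitted_mono (hω : TypicalClocks ω) (ha : ∀ e, 0 ≤ a e) {I J : Set ℝ} (hJ : BddAbove J)
    (hIJ : I ⊆ J) (x : Site d) : emitted ω a x I ≤ emitted ω a x J := by
  unfold emitted
  rw [finsum_mem_eq_finite_toFinset_sum _ (hω.finite_preimage hJ x),
    finsum_mem_eq_finite_toFinset_sum _ (hω.finite_preimage (hJ.mono hIJ) x)]
  refine Finset.sum_le_sum_of_subset_of_nonneg ?_ fun n _ _ => ha (x, n)
  exact Set.Finite.toFinset_subset_toFinset.2 (Set.preimage_mono hIJ)

lemma emitted_add_le (hω : TypicalClocks ω) (ha : ∀ e, 0 ≤ a e) {I J : Set ℝ} (hJ : BddAbove J)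
    (hIJ : I ⊆ J) {x : Site d} {n : ℕ} (hn : ringTime (ω x) n ∉ I) (hnJ : ringTime (ω x) n ∈ J) :
    emitted ω a x I + a (x, n) ≤ emitted ω a x J := by
  have h := emitted_insert (a := a) hω (J := insert (ringTime (ω x) n) I) (hJ.mono hIJ) hn (by
    ext m
    simp [(ringTime_strictMono (hω.pos x)).injective.eq_iff])
  rw [add_comm, ← h]
  exact emitted_mono hω ha hJ (Set.insert_subset hnJ hIJ) x

lemma emitted_eq_sum_range {x : Site d} {I : Set ℝ} {k : ℕ}
    (h : ∀ m, ringTime (ω x) m ∈ I ↔ m < k) :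
    emitted ω a x I = ∑ m ∈ Finset.range k, a (x, m) := by
  unfold emitted
  rw [← finsum_mem_coe_finset]
  have hset : ringTime (ω x) ⁻¹' I = ↑(Finset.range k) := by
    ext m
    simpa using h m
  rw [hset]

lemma emitted_Iio_ringTime (hω : TypicalClocks ω) (x : Site d) (n : ℕ) :
    emitted ω a x (Set.Iio (ringTime (ω x) n)) = ∑ m ∈ Finset.range n, a (x, m) :=
  emitted_eq_sum_range fun m => by
    simp [(ringTime_strictMono (hω.pos x)).lt_iff_lt]

lemma inflow_mono (hω : TypicalClocks ω) (ha : ∀ e, 0 ≤ a e) {I J : Set ℝ} (hJ : BddAbove J)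
    (hIJ : I ⊆ J) (x : Site d) :
    (∑ y ∈ nbrs x, emitted ω a y I) / (2 * d) ≤ (∑ y ∈ nbrs x, emitted ω a y J) / (2 * d) := by
  gcongr with y
  exact emitted_mono hω ha hJ hIJ y

/-- Between its own rings a site only gains mass, and at a ring it loses at most what it has. -/
lemma IsEmission.height_ringTime_nonneg (hω : TypicalClocks ω) (ha : IsEmission ω η a)
    (x : Site d) (n : ℕ) : 0 ≤ height ω η a x (Set.Iio (ringTime (ω x) n)) ∧
      a (x, n) ≤ height ω η a x (Set.Iio (ringTime (ω x) n)) := by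
  have key : ∀ n, 0 ≤ height ω η a x (Set.Iio (ringTime (ω x) n)) →
      a (x, n) ≤ height ω η a x (Set.Iio (ringTime (ω x) n)) := fun n h => by
    by_cases ht : Topples ω η a (x, n)
    · exact (ha.eq_height ht).le
    · exact (ha.eq_zero ht).trans_le h
  suffices h : 0 ≤ height ω η a x (Set.Iio (ringTime (ω x) n)) from ⟨h, key n h⟩
  induction n with
  | zero =>
    rw [height, emitted_Iio_ringTime hω, Finset.sum_range_zero, sub_zero]
    have : 0 ≤ ∑ y ∈ nbrs x, emitted ω a y (Set.Iio (ringTime (ω x) 0)) :=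
      Finset.sum_nonneg fun y _ => emitted_nonneg ha.nonneg y _
    positivity
  | succ n ih =>
    have h1 := key n ih
    have h2 := inflow_mono hω ha.nonneg (I := Set.Iio (ringTime (ω x) n))
      (J := Set.Iio (ringTime (ω x) (n + 1))) bddAbove_Iio
      (Set.Iio_subset_Iio (ringTime_strictMono (hω.pos x) n.lt_succ_self).le) x
    rw [height, emitted_Iio_ringTime hω] at h1 ⊢
    rw [Finset.sum_range_succ]
    linarith

/-- Reduction to the last ring of `x` in `I`. It ensures that `Real.toNNReal` truncates nothing when
heights become configurations. -/
lemma IsEmission.height_nonneg (hω : TypicalClocks ω) (ha : IsEmission ω η a) (x : Site d)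
    {I : Set ℝ} (hI : BddAbove I) (hI' : IsLowerSet I) : 0 ≤ height ω η a x I := by
  classical
  have hex : ∃ n, ringTime (ω x) n ∉ I := by
    obtain ⟨t, ht⟩ := hI
    obtain ⟨n, hn⟩ := ((hω.tendsto x).eventually_gt_atTop t).exists
    exact ⟨n, fun h => absurd (ht h) (not_le.2 hn)⟩
  have hk : ∀ m, ringTime (ω x) m ∈ I ↔ m < Nat.find hex := fun m => by
    refine ⟨fun hm => ?_, fun hm => by simpa using Nat.find_min hex hm⟩
    by_contra! hle
    exact Nat.find_spec hex
      (hI' ((ringTime_strictMono (hω.pos x)).monotone hle) hm)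
  have hin : 0 ≤ ∑ y ∈ nbrs x, emitted ω a y I :=
    Finset.sum_nonneg fun y _ => emitted_nonneg ha.nonneg y _
  rcases h : Nat.find hex with _ | n
  · rw [height, emitted_eq_sum_range hk, h, Finset.sum_range_zero, sub_zero]
    positivity
  · have hn : ringTime (ω x) n ∈ I := (hk n).2 (by omega)
    have h1 := (ha.height_ringTime_nonneg hω x n).2
    have h2 := inflow_mono hω ha.nonneg (I := Set.Iio (ringTime (ω x) n)) hI
      (fun s hs => hI' (le_of_lt hs) hn) x
    rw [height, emitted_Iio_ringTime hω] at h1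
    rw [height, emitted_eq_sum_range hk, h, Finset.sum_range_succ]
    linarith

/-! ### Construction of the process -/

lemma height_congr {x : Site d} {I J : Set ℝ}
    (hx : ringTime (ω x) ⁻¹' I = ringTime (ω x) ⁻¹' J)
    (hy : ∀ y ∈ nbrs x, ringTime (ω y) ⁻¹' I = ringTime (ω y) ⁻¹' J) :
    height ω η a x I = height ω η a x J := by
  unfold height emitted
  rw [hx, Finset.sum_congr rfl fun y h => by rw [hy y h]]

lemma TypicalClocks.eventually_left (hω : TypicalClocks ω) (y : Site d) (t : ℝ) :
    ∀ᶠ s in 𝓝[<] t, ringTime (ω y) ⁻¹' Set.Iic s = ringTime (ω y) ⁻¹' Set.Iio t := by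
  have h1 : ∀ᶠ s in 𝓝[<] t, ∀ n ∈ ringTime (ω y) ⁻¹' Set.Iio t, ringTime (ω y) n ≤ s :=
    (eventually_all_finite (hω.finite_preimage bddAbove_Iio y)).2 fun n hn =>
      mem_nhdsWithin_of_mem_nhds (Ici_mem_nhds hn)
  filter_upwards [h1, self_mem_nhdsWithin] with s hs hst
  ext n
  simp only [Set.mem_preimage, Set.mem_Iic, Set.mem_Iio] at hs hst ⊢
  exact ⟨fun h => lt_of_le_of_lt h hst, fun h => hs n h⟩

lemma TypicalClocks.eventually_right (hω : TypicalClocks ω) (y : Site d) (t : ℝ) :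
    ∀ᶠ s in 𝓝[>] t, ringTime (ω y) ⁻¹' Set.Iic s = ringTime (ω y) ⁻¹' Set.Iic t := by
  have h1 : ∀ᶠ s in 𝓝[>] t, ∀ n ∈ ringTime (ω y) ⁻¹' Set.Ioc t (t + 1), s < ringTime (ω y) n :=
    (eventually_all_finite (hω.finite_preimage bddAbove_Ioc y)).2 fun n hn =>
      mem_nhdsWithin_of_mem_nhds (Iio_mem_nhds hn.1)
  have h2 : ∀ᶠ s in 𝓝[>] t, s < t + 1 :=
    mem_nhdsWithin_of_mem_nhds (Iio_mem_nhds (by linarith))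
  filter_upwards [h1, h2, self_mem_nhdsWithin] with s hs hs1 hst
  ext n
  simp only [Set.mem_preimage, Set.mem_Iic, Set.mem_Ioi, Set.mem_Ioc] at hs hst ⊢
  refine ⟨fun h => ?_, fun h => le_trans h (le_of_lt hst)⟩
  by_contra hn
  exact absurd h (not_le.2 (hs n ⟨not_le.1 hn, le_trans h hs1.le⟩))

lemma preimage_Iic_of_notMem (y : Site d) {t : ℝ} (h : t ∉ rings ω y) :
    ringTime (ω y) ⁻¹' Set.Iic t = ringTime (ω y) ⁻¹' Set.Iio t := by
  ext n
  simp only [Set.mem_preimage, Set.mem_Iic, Set.mem_Iio]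
  exact ⟨fun hn => lt_of_le_of_ne hn fun heq => h ⟨n, heq⟩, fun hn => le_of_lt hn⟩

lemma TypicalClocks.emitted_Iic (hω : TypicalClocks ω) (x z : Site d) (n : ℕ) [Decidable (z = x)] :
    emitted ω a z (Set.Iic (ringTime (ω x) n)) =
      emitted ω a z (Set.Iio (ringTime (ω x) n)) + if z = x then a (x, n) else 0 := by
  split_ifs with h
  · subst h
    rw [emitted_insert hω (I := Set.Iio (ringTime (ω z) n)) bddAbove_Iio (n := n)
      (by simp), add_comm]
    ext m
    simp [(ringTime_strictMono (hω.pos z)).lt_iff_lt, (ringTime_strictMono (hω.pos z)).le_iff_le,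
      le_iff_lt_or_eq, or_comm]
  · unfold emitted
    rw [preimage_Iic_of_notMem, add_zero]
    rintro ⟨m, hm⟩
    exact hω.ne z x h m n hm

open Classical in
-- The effect of a single ring; no other site rings at the same time.
lemma TypicalClocks.height_Iic (hω : TypicalClocks ω) (x z : Site d) (n : ℕ) :
    height ω η a z (Set.Iic (ringTime (ω x) n)) =
      height ω η a z (Set.Iio (ringTime (ω x) n)) + (if Adj x z then a (x, n) / (2 * d) else 0)
        - if z = x then a (x, n) else 0 := by
  unfold height
  simp only [hω.emitted_Iic, Finset.sum_add_distrib, Finset.sum_ite_eq', mem_nbrs, add_div,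
    ite_div, zero_div, adj_comm (x := z)]
  ring

lemma IsEmission.isTopplingProcess (hω : TypicalClocks ω) (ha : IsEmission ω η a) :
    IsTopplingProcess ω η (fun t x => (height ω η a x (Set.Iic t)).toNNReal)
      (fun t x => (height ω η a x (Set.Iio t)).toNNReal) where
  init := by
    have h0 : ∀ x, emitted ω a x (Set.Iic 0) = 0 := fun x => by
      rw [emitted_eq_sum_range (k := 0), Finset.sum_range_zero]
      simpa using fun m => ringTime_pos (hω.pos x) m
    ext x
    simp [height, h0]
  left_limit t _ x := by
    filter_upwards [hω.eventually_left x t,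
      (eventually_all_finset (nbrs x)).2 fun y _ => hω.eventually_left y t] with s h1 h2
    rw [height_congr h1 h2]
  right_cont t _ x := by
    filter_upwards [hω.eventually_right x t,
      (eventually_all_finset (nbrs x)).2 fun y _ => hω.eventually_right y t] with s h1 h2
    rw [height_congr h1 h2]
  ring := by
    rintro t - x ⟨n, hn⟩
    have hn : ringTime (ω x) n = t := hn
    subst hn
    have h0 : ∀ z, 0 ≤ height ω η a z (Set.Iio (ringTime (ω x) n)) := fun z =>
      ha.height_nonneg hω z bddAbove_Iio (isLowerSet_Iio _)
    funext z
    rw [hω.height_Iic]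
    unfold topple
    by_cases ht : 1 ≤ height ω η a x (Set.Iio (ringTime (ω x) n))
    · have hx : a (x, n) = height ω η a x (Set.Iio (ringTime (ω x) n)) := ha.eq_height ht
      rw [if_pos (Real.one_le_toNNReal.2 ht), hx]
      by_cases hz : z = x
      · subst hz
        simp [not_adj_self]
      · by_cases hadj : Adj x z
        · rw [if_pos hadj, if_neg hz, if_neg hz, if_pos hadj, sub_zero,
            Real.toNNReal_add (h0 z) (div_nonneg (h0 x) (by positivity)),
            Real.toNNReal_div (h0 x)]
          congr 2
          ext
          simp
        · simp [hz, hadj]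
    · have hx : a (x, n) = 0 := ha.eq_zero ht
      rw [if_neg (mt Real.one_le_toNNReal.1 ht), hx]
      simp
  no_ring t _ h := by
    funext x
    rw [height_congr (preimage_Iic_of_notMem x (h x))
      fun y _ => preimage_Iic_of_notMem y (h y)]

end


/-! ### Sites topple infinitely often -/

section

variable {d : ℕ} {ω : Site d → ℕ → ℝ} {η : Config d} {a : Site d × ℕ → ℝ}

lemma IsEmission.one_le_emitted (hω : TypicalClocks ω) (ha : IsEmission ω η a) {z : Site d} {n : ℕ}
    (h : Topples ω η a (z, n)) {t : ℝ} (ht : ringTime (ω z) n < t) :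
    1 ≤ emitted ω a z (Set.Iio t) := by
  have h1 := emitted_add_le hω ha.nonneg bddAbove_Iio (Set.empty_subset (Set.Iio t))
    (Set.notMem_empty (ringTime (ω z) n)) ht
  linarith [emitted_nonneg (ω := ω) ha.nonneg z ∅, ha.one_le h]

/-- A site topples if it has neighbours that topple and from which it receives enough mass. -/
lemma IsEmission.exists_topples (hω : TypicalClocks ω) (ha : IsEmission ω η a) {y : Site d}
    {F : Finset (Site d)} (hF : F ⊆ nbrs y) (htop : ∀ z ∈ F, ∃ n, Topples ω η a (z, n))
    (h : 1 ≤ (η y : ℝ) + F.card / (2 * d)) : ∃ n, Topples ω η a (y, n) := by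
  by_contra! hne
  choose! n hn using htop
  -- A ring of `y` after one toppling of each site of `F`: if `y` has never toppled, it has lost
  -- nothing and gained at least `F.card / (2 * d)`.
  obtain ⟨N, hN⟩ := ((eventually_all_finset F).2 fun z _ =>
    (hω.tendsto y).eventually_gt_atTop (ringTime (ω z) (n z))).exists
  refine hne N ?_
  have hin : (F.card : ℝ) ≤ ∑ z ∈ nbrs y, emitted ω a z (Set.Iio (ringTime (ω y) N)) := by
    calc (F.card : ℝ) = ∑ z ∈ F, 1 := by simp
      _ ≤ ∑ z ∈ F, emitted ω a z (Set.Iio (ringTime (ω y) N)) :=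
        Finset.sum_le_sum fun z hz => ha.one_le_emitted hω (hn z hz) (hN z hz)
      _ ≤ _ := Finset.sum_le_sum_of_subset_of_nonneg hF
        fun z _ _ => emitted_nonneg ha.nonneg z _
  have hout : emitted ω a y (Set.Iio (ringTime (ω y) N)) = 0 := by
    rw [emitted_Iio_ringTime hω]
    exact Finset.sum_eq_zero fun m _ => ha.eq_zero (hne m)
  have hdiv : (F.card : ℝ) / (2 * d) ≤
      (∑ z ∈ nbrs y, emitted ω a z (Set.Iio (ringTime (ω y) N))) / (2 * d) := by gcongr
  unfold Topples height
  simp only [hout]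
  linarith

/-- If every site topples at least once, then some site topples infinitely often: otherwise
consider a site whose last toppling precedes the last toppling of each of its neighbours. -/
lemma IsEmission.exists_infinite (hd : 1 ≤ d) (hω : TypicalClocks ω) (ha : IsEmission ω η a)
    (htop : ∀ x, ∃ n, Topples ω η a (x, n)) : ∃ x, {n | Topples ω η a (x, n)}.Infinite := by
  by_contra hfin
  rw [not_exists] at hfin
  have hlast : ∀ x, ∃ n, Topples ω η a (x, n) ∧ ∀ m, Topples ω η a (x, m) → m ≤ n := fun x =>
    Set.exists_max_image _ id (Set.not_infinite.1 (hfin x)) (htop x)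
  choose L hL hmax using hlast
  -- A causally minimal last toppling: those of the neighbours all come strictly later.
  obtain ⟨_, ⟨x, rfl⟩, hmin⟩ := hω.wf.has_min (Set.range fun x => (x, L x)) ⟨_, ⟨0, rfl⟩⟩
  have hlt : ∀ y ∈ nbrs x, ringTime (ω x) (L x) < ringTime (ω y) (L y) := fun y hy => by
    have hadj := mem_nbrs.1 hy
    have hne : x ≠ y := fun h => not_adj_self x (by rwa [← h] at hadj)
    refine lt_of_le_of_ne (not_lt.1 fun h => ?_) (hω.ne x y hne _ _)
    exact hmin (y, L y) ⟨y, rfl⟩ ⟨h, Or.inr hadj⟩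
  obtain ⟨N, hN, hLN⟩ := (((eventually_all_finset (nbrs x)).2 fun y _ =>
    (hω.tendsto x).eventually_gt_atTop (ringTime (ω y) (L y))).and
      (eventually_gt_atTop (L x))).exists
  refine absurd (hmax x N ?_) (not_le.2 hLN)
  have hTN : ringTime (ω x) (L x) < ringTime (ω x) N := ringTime_strictMono (hω.pos x) hLN
  have hout : ∑ m ∈ Finset.range N, a (x, m) = ∑ m ∈ Finset.range (L x + 1), a (x, m) := by
    refine (Finset.sum_subset (Finset.range_subset_range.2 hLN) fun m _ hm => ?_).symm
    refine ha.eq_zero fun h => hm (Finset.mem_range.2 (Nat.lt_succ_of_le (hmax x m h)))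
  -- The last toppling at `x` emits the whole height, so the outflow up to and including it equals
  -- the initial height plus the inflow before it.
  have hzero := ha.eq_height (hL x)
  have hin : (∑ y ∈ nbrs x, emitted ω a y (Set.Iio (ringTime (ω x) (L x)))) + 2 * d ≤
      ∑ y ∈ nbrs x, emitted ω a y (Set.Iio (ringTime (ω x) N)) := by
    have hcard : (2 * d : ℝ) ≤ ∑ y ∈ nbrs x, (1 : ℝ) := by
      rw [Finset.sum_const, nsmul_one]
      exact_mod_cast two_mul_le_card_nbrs x
    refine (add_le_add_right hcard _).trans ?_
    rw [← Finset.sum_add_distrib]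
    refine Finset.sum_le_sum fun y hy => ?_
    refine le_trans ?_ (emitted_add_le hω ha.nonneg bddAbove_Iio
      (Set.Iio_subset_Iio hTN.le) (n := L y) (fun h => lt_asymm h (hlt y hy)) (hN y hy))
    exact add_le_add_right (ha.one_le (hL y)) _
  have hd0 : (0 : ℝ) < 2 * d := by positivity
  have hdiv := div_le_div_of_nonneg_right hin hd0.le
  rw [add_div, div_self hd0.ne'] at hdiv
  unfold Topples
  rw [height, emitted_Iio_ringTime hω] at hzero ⊢
  rw [hout, Finset.sum_range_succ]
  linarith

lemma iSup_topplingCount_eq_top (hω : TypicalClocks ω) {x : Site d}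
    (h : {n | Topples ω η a (x, n)}.Infinite) :
    ⨆ t : ℝ, topplingCount ω (fun t x => (height ω η a x (Set.Iio t)).toNNReal) x t = ⊤ := by
  refine ENat.eq_top_iff_forall_ge.2 fun m => ?_
  obtain ⟨F, hF, rfl⟩ := h.exists_subset_card_eq m
  obtain ⟨t, ht⟩ := (F.finite_toSet.image (ringTime (ω x))).bddAbove
  refine le_trans ?_ (le_iSup _ t)
  have hinj : Function.Injective (ringTime (ω x)) := (ringTime_strictMono (hω.pos x)).injective
  rw [← Set.encard_coe_eq_coe_finsetCard, ← hinj.encard_image]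
  refine Set.encard_le_encard ?_
  rintro _ ⟨n, hn, rfl⟩
  exact ⟨ringTime_pos (hω.pos x) n, ht ⟨n, hn, rfl⟩, ⟨n, rfl⟩, Real.one_le_toNNReal.2 (hF hn)⟩

end

/-- One clock realization that is both typical and in the almost sure event suffices; the
constructed process contradicts finiteness there. -/
theorem not_stabilizableConfig {d : ℕ} (hd : 1 ≤ d) {η : Config d}
    (h : ∀ ω a, TypicalClocks ω → IsEmission ω η a → ∀ x, ∃ n, Topples ω η a (x, n)) :
    ¬ StabilizableConfig η := by
  intro hs
  obtain ⟨ω, hω, hω'⟩ := ((ae_typicalClocks d).and hs).exists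
  obtain ⟨a, ha⟩ := hω.exists_isEmission η
  obtain ⟨x, hx⟩ := ha.exists_infinite hd hω (h ω a hω ha)
  exact (hω' _ _ (ha.isTopplingProcess hω) x).ne (iSup_topplingCount_eq_top hω hx)

/-! ### Layered configurations -/

/-- The configuration with height `a` on one out of `N` diagonal layers and height `b` on the
others. -/
def layered (d N : ℕ) (a b : ℝ≥0) (k : ZMod N) : Config d := fun x =>
  if k + ((∑ i, x i : ℤ) : ZMod N) = 0 then a else b

/-- The uniform distribution on the translates of a layered configuration. -/
noncomputable def layeredMeasure (d N : ℕ) [NeZero N] (a b : ℝ≥0) : Measure (Config d) :=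
  (N : ℝ≥0∞)⁻¹ • ∑ k : ZMod N, Measure.dirac (layered d N a b k)

section

variable {d N : ℕ} {a b : ℝ≥0}

lemma vadd_layered (g : (Site d)ᵈᵃᵃ) (k : ZMod N) :
    g +ᵥ layered d N a b k =
      layered d N a b (k + ((∑ i, DomAddAct.mk.symm g i : ℤ) : ZMod N)) := by
  funext x
  simp only [DomAddAct.vadd_apply, layered, vadd_eq_add, Pi.add_apply, Finset.sum_add_distrib,
    Int.cast_add, add_assoc]

variable [NeZero N]

lemma layeredMeasure_apply (s : Set (Config d)) :
    layeredMeasure d N a b s =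
      (N : ℝ≥0∞)⁻¹ * ∑ k : ZMod N, s.indicator 1 (layered d N a b k) := by
  simp [layeredMeasure]

lemma ae_layeredMeasure_iff {p : Config d → Prop} :
    (∀ᵐ η ∂layeredMeasure d N a b, p η) ↔ ∀ k : ZMod N, p (layered d N a b k) := by
  rw [ae_iff, layeredMeasure_apply]
  simp

lemma isProbabilityMeasure_layeredMeasure : IsProbabilityMeasure (layeredMeasure d N a b) := by
  refine ⟨?_⟩
  rw [layeredMeasure_apply]
  simp only [Set.indicator_univ, Pi.one_apply, Finset.sum_const, Finset.card_univ, ZMod.card,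
    nsmul_one]
  exact ENNReal.inv_mul_cancel (by exact_mod_cast NeZero.ne N) (by simp)

/-- Translations act on the label `k` by addition in `ZMod N`, which gives invariance. They act
transitively on labels and every atom has positive mass, so an invariant set contains all atoms or
none. -/
lemma ergodicVAdd_layeredMeasure (hd : 1 ≤ d) :
    ErgodicVAdd (Site d)ᵈᵃᵃ (Config d) (layeredMeasure d N a b) where
  measure_preimage_vadd g s _ := by
    rw [layeredMeasure_apply, layeredMeasure_apply]
    congr 1
    refine Fintype.sum_equiv (Equiv.addRight ((∑ i, DomAddAct.mk.symm g i : ℤ) : ZMod N)) _ _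
      fun k => ?_
    rw [Equiv.coe_addRight, ← vadd_layered]
    rfl
  aeconst_of_forall_preimage_vadd_ae_eq {s} _ h := by
    have key : ∀ k : ZMod N, layered d N a b k ∈ s ↔ layered d N a b 0 ∈ s := fun k => by
      have h1 := ae_layeredMeasure_iff.1
        (eventuallyEq_set.1 (h (DomAddAct.mk (Pi.single ⟨0, hd⟩ (k.val : ℤ))))) 0
      rw [Set.mem_preimage, vadd_layered] at h1
      simpa using h1
    rw [eventuallyConst_set]
    by_cases h0 : layered d N a b 0 ∈ s
    · exact Or.inl (ae_layeredMeasure_iff.2 fun k => (key k).2 h0)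
    · exact Or.inr (ae_layeredMeasure_iff.2 fun k => (key k).not.2 h0)

lemma lintegral_layeredMeasure {ρ : ℝ} (h : (a : ℝ) + (N - 1) * b = N * ρ) :
    ∫⁻ η, (η 0 : ℝ≥0∞) ∂layeredMeasure d N a b = ENNReal.ofReal ρ := by
  have hN : (0 : ℝ) < N := by exact_mod_cast NeZero.pos N
  have hsum : ((∑ k : ZMod N, if k = 0 then a else b : ℝ≥0) : ℝ) = N * ρ := by
    have : ∀ k : ZMod N, ((if k = 0 then a else b : ℝ≥0) : ℝ) =
        b + if k = 0 then (a : ℝ) - b else 0 := fun k => by split_ifs <;> simp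
    rw [NNReal.coe_sum]
    rw [Finset.sum_congr rfl fun k _ => this k, Finset.sum_add_distrib]
    simp only [Finset.sum_const, Finset.card_univ, ZMod.card, nsmul_eq_mul, Finset.sum_ite_eq',
      Finset.mem_univ, if_true]
    linarith
  unfold layeredMeasure
  rw [lintegral_smul_measure, lintegral_finsetSum_measure]
  simp only [lintegral_dirac, layered, Pi.zero_apply, Finset.sum_const_zero, Int.cast_zero, add_zero]
  rw [← ENNReal.ofNNReal_finsetSum, ← ENNReal.ofReal_coe_nnreal, hsum, smul_eq_mul,
    ← ENNReal.ofReal_natCast, ← ENNReal.ofReal_inv_of_pos hN,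
    ← ENNReal.ofReal_mul (by positivity), inv_mul_cancel_left₀ hN.ne']

lemma isErgodicWithDensity_layeredMeasure (hd : 1 ≤ d) {ρ : ℝ}
    (h : (a : ℝ) + (N - 1) * b = N * ρ) :
    IsErgodicWithDensity (layeredMeasure d N a b) ρ where
  prob := isProbabilityMeasure_layeredMeasure
  ergodic := ergodicVAdd_layeredMeasure hd
  density := lintegral_layeredMeasure h

lemma layeredMeasure_stabilizableSet
    (h : ∀ k : ZMod N, ¬ StabilizableConfig (layered d N a b k)) :
    ¬ StabilizableMeasure (layeredMeasure d N a b) ∧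
      layeredMeasure d N a b (stabilizableSet d) = 0 := by
  have h0 : layeredMeasure d N a b (stabilizableSet d) = 0 := by
    have := ae_iff.1 (ae_layeredMeasure_iff (p := fun η => ¬ StabilizableConfig η).2 h)
    simpa [stabilizableSet] using this
  refine ⟨?_, h0⟩
  unfold StabilizableMeasure
  rw [h0]
  exact zero_ne_one

end

/-! ### Toppling of every site in layered configurations -/

lemma Adj.intCast_sum {d : ℕ} {x y : Site d} (h : Adj x y) :
    ((∑ i, y i : ℤ) : ZMod 2) = ((∑ i, x i : ℤ) : ZMod 2) + 1 := by
  have habs : ∀ z : ℤ, ((|z| : ℤ) : ZMod 2) = z := fun z => by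
    rcases abs_choice z with hz | hz <;> rw [hz]
    rw [Int.cast_neg, ZMod.neg_eq_self_mod_two]
  have h1 : ((∑ i, |y i - x i| : ℤ) : ZMod 2) = 1 := by rw [h, Int.cast_one]
  rw [Int.cast_sum] at h1
  simp only [habs, Int.cast_sub, Finset.sum_sub_distrib] at h1
  rw [Int.cast_sum, Int.cast_sum, ← h1]
  ring

lemma not_stabilizableConfig_layered_two {d : ℕ} (hd : 1 ≤ d) {a b : ℝ≥0} (ha : 1 ≤ a)
    (k : ZMod 2) : ¬ StabilizableConfig (layered d 2 a b k) := by
  refine not_stabilizableConfig hd fun ω e hω he => ?_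
  have heven : ∀ x : Site d, k + ((∑ i, x i : ℤ) : ZMod 2) = 0 →
      ∃ n, Topples ω (layered d 2 a b k) e (x, n) := fun x hx => by
    refine he.exists_topples hω (Finset.empty_subset _) (by simp) ?_
    rw [layered, if_pos hx]
    simpa using ha
  intro x
  by_cases hx : k + ((∑ i, x i : ℤ) : ZMod 2) = 0
  · exact heven x hx
  refine he.exists_topples hω subset_rfl (fun z hz => heven z ?_) ?_
  · rw [(mem_nbrs.1 hz).intCast_sum, ← add_assoc]
    generalize k + ((∑ i, x i : ℤ) : ZMod 2) = c at hx ⊢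
    revert c
    decide
  · have h2d : (0 : ℝ) < 2 * d := by positivity
    have h1 : (1 : ℝ) ≤ (nbrs x).card / (2 * d) := by
      rw [le_div_iff₀ h2d, one_mul]
      exact_mod_cast two_mul_le_card_nbrs x
    exact le_add_of_nonneg_of_le (NNReal.coe_nonneg _) h1

lemma not_stabilizableConfig_layered {d N : ℕ} [NeZero N] (hd : 1 ≤ d) {a b : ℝ≥0} (ha : 1 ≤ a)
    (hb : 1 - 1 / (2 * (d : ℝ)) ≤ b) (k : ZMod N) :
    ¬ StabilizableConfig (layered d N a b k) := by
  refine not_stabilizableConfig hd fun ω e hω he => ?_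
  -- Induction on a natural number representing the layer; a step by `-1` in the first coordinate
  -- leads to the previous layer.
  have key : ∀ (j : ℕ) (x : Site d), k + ((∑ i, x i : ℤ) : ZMod N) = j →
      ∃ n, Topples ω (layered d N a b k) e (x, n) := by
    intro j
    have hpos : ∀ x : Site d, k + ((∑ i, x i : ℤ) : ZMod N) = 0 →
        ∃ n, Topples ω (layered d N a b k) e (x, n) := fun x hx => by
      refine he.exists_topples hω (Finset.empty_subset _) (by simp) ?_
      rw [layered, if_pos hx]
      simpa using ha
    induction j with
    | zero => exact fun x hx => hpos x (by simpa using hx)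
    | succ j ih =>
      intro x hx
      by_cases hx0 : k + ((∑ i, x i : ℤ) : ZMod N) = 0
      · exact hpos x hx0
      have hadj := adj_add_single x ⟨0, hd⟩ (s := -1) (by simp)
      refine he.exists_topples hω (Finset.singleton_subset_iff.2 (mem_nbrs.2 hadj)) ?_ ?_
      · intro z hz
        rw [Finset.mem_singleton.1 hz]
        refine ih _ ?_
        simp only [Pi.add_apply, Finset.sum_add_distrib, Finset.sum_pi_single', Finset.mem_univ,
          if_true, Int.cast_add, ← add_assoc, hx]
        push_cast
        ring
      · rw [layered, if_neg hx0, Finset.card_singleton, Nat.cast_one]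
        linarith
  exact fun x => key (k + ((∑ i, x i : ℤ) : ZMod N)).val x (by simp)

lemma layered_two_eq_checkerboard {d : ℕ} (hd : 1 ≤ d) (m : ℝ≥0) (k : ZMod 2) :
    ∃ v : Site d, ∀ x, layered d 2 m 0 k x = checkerboard d m (x + v) := by
  refine ⟨Pi.single ⟨0, hd⟩ (k.val : ℤ), fun x => ?_⟩
  unfold layered checkerboard
  refine if_congr ?_ rfl rfl
  rw [even_iff_two_dvd, ← Nat.cast_ofNat (R := ℤ), ← ZMod.intCast_zmod_eq_zero_iff_dvd]
  simp [Finset.sum_add_distrib, add_comm]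

end ZhangSandpile
/-- Non-stabilizable ergodic measures for Zhang's sandpile on `ℤ^d`, with density close to `1/2`
(translates of a checkerboard with masses `2ρ` and `0`) and with density close to `1` (heights
all at least `1 - 1/(2d)`). -/
theorem theorem4p4 (d : ℕ) (hd : 1 ≤ d) (ρ : ℝ) :
    ((1 / 2 ≤ ρ ∧ ρ < (d : ℝ) / (2 * (d : ℝ) - 1)) →
      ∃ μ : MeasureTheory.Measure (ZhangSandpile.Config d),
        ZhangSandpile.IsErgodicWithDensity μ ρ ∧
        (∀ᵐ η ∂μ, ∃ v : ZhangSandpile.Site d, ∀ x : ZhangSandpile.Site d,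
          η x = ZhangSandpile.checkerboard d (Real.toNNReal (2 * ρ)) (x + v)) ∧
        ¬ ZhangSandpile.StabilizableMeasure μ ∧
        μ (ZhangSandpile.stabilizableSet d) = 0) ∧
    (((2 * (d : ℝ) - 1) / (2 * (d : ℝ)) < ρ ∧ ρ < 1) →
      ∃ μ : MeasureTheory.Measure (ZhangSandpile.Config d),
        ZhangSandpile.IsErgodicWithDensity μ ρ ∧
        (∀ᵐ η ∂μ, ∀ x : ZhangSandpile.Site d, 1 - 1 / (2 * (d : ℝ)) ≤ (η x : ℝ)) ∧
        ¬ ZhangSandpile.StabilizableMeasure μ ∧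
        μ (ZhangSandpile.stabilizableSet d) = 0) := by
  have hd1 : (1 : ℝ) ≤ d := by exact_mod_cast hd
  constructor
  · rintro ⟨h1, -⟩
    have hm : 1 ≤ Real.toNNReal (2 * ρ) := Real.one_le_toNNReal.2 (by linarith)
    refine ⟨ZhangSandpile.layeredMeasure d 2 (Real.toNNReal (2 * ρ)) 0,
      ZhangSandpile.isErgodicWithDensity_layeredMeasure hd ?_,
      ZhangSandpile.ae_layeredMeasure_iff.2 (ZhangSandpile.layered_two_eq_checkerboard hd _),
      ZhangSandpile.layeredMeasure_stabilizableSet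
        (ZhangSandpile.not_stabilizableConfig_layered_two hd hm)⟩
    rw [Real.coe_toNNReal _ (by linarith)]
    simp
  · rintro ⟨h1, -⟩
    set β : ℝ := 1 - 1 / (2 * (d : ℝ)) with hβ
    have hβ0 : 0 ≤ β := by
      rw [hβ, sub_nonneg, div_le_one (by positivity)]
      linarith
    have hβρ : 0 < ρ - β := by
      have : (2 * (d : ℝ) - 1) / (2 * (d : ℝ)) = β := by
        rw [hβ]; field_simp
      linarith
    -- Heights `β + N (ρ - β)` on one layer and `β` on the other `N - 1` have mean `ρ`; this `N`
    -- makes the first height at least `1`.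
    obtain ⟨N, hN⟩ := exists_nat_ge (1 / (ρ - β))
    rw [div_le_iff₀ hβρ] at hN
    have : NeZero N := ⟨by rintro rfl; norm_num at hN⟩
    have ha : 1 ≤ Real.toNNReal (β + N * (ρ - β)) := Real.one_le_toNNReal.2 (by linarith)
    have hb : β ≤ (Real.toNNReal β : ℝ) := Real.le_coe_toNNReal β
    refine ⟨ZhangSandpile.layeredMeasure d N (Real.toNNReal (β + N * (ρ - β))) (Real.toNNReal β),
      ZhangSandpile.isErgodicWithDensity_layeredMeasure hd ?_,
      ZhangSandpile.ae_layeredMeasure_iff.2 fun k x => ?_,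
      ZhangSandpile.layeredMeasure_stabilizableSet
        (ZhangSandpile.not_stabilizableConfig_layered hd ha hb)⟩
    · rw [Real.coe_toNNReal _ (by linarith), Real.coe_toNNReal _ hβ0]
      ring
    · unfold ZhangSandpile.layered
      split_ifs
      · exact (Real.le_coe_toNNReal _).trans' (by linarith)
      · exact hb
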